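/- **Proposition.** Let $T$ be an alphabet containing two distinct letters $a\neq b$ (for instance $T=\{a,b\}$). The following problem is undecidable: given an indexed grammar $G$ with terminal alphabet $T$ whose generated language $L=\mathsf{L}(G)$ satisfies $L\subseteq a^*b^*$, decide whether there is an $n\in\mathbb{N}$ (with $0 \in \mathbb{N}$) such that $a^nb^n\in L$. That is, there is no algorithm that halts on every indexed grammar $G$ over $T$ with $\mathsf{L}(G)\subseteq a^*b^*$ and correctly answers whether $a^nb^n\in \mathsf{L}(G)$ for some $n$ (whatever it does on other inputs). Here an *indexed grammar* is a tuple $G=(N,T,I,P,S)$ with pairwise disjoint alphabets $N$ (nonterminals), $T$ (terminals), $I$ (index symbols), a start symbol $S\in N$, and a finite set $P$ of productions of the forms $A\to w$, $A\to Bf$, $Af\to w$ with $A,B\in N$, $f\in I$, $w\in(N\cup T)^*$. For $w\in(N\cup T)^*$ and $x\in I^*$ let $[w,x]$ be obtained from $w$ by replacing each $A\in N$ by $Ax$. For $q,r\in (NI^*\cup T)^*$ write $q\Rightarrow r$ if $q=q_1Axq_2$ and $r=q_1[p,y]q_2$ for some $q_1,q_2\in (NI^*\cup T)^*$, $A\in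 N$, $p\in(N\cup T)^*$, $x,y\in I^*$ such that one of the following holds: (i) $A\to p$ is in $P$, $p\notin T^*$, and $y=x$; (ii) $A\to p$ is in $P$, $p\in T^*$, and $x=y=\varepsilon$; (iii) $p \in N$, $A\to pf$ is in $P$ and $y=fx$ for some $f\in I$; (iv) $Af\to p$ is in $P$ and $x=fy$ for some $f\in I$. The language generated by $G$ is $\mathsf{L}(G)=\{w\in T^*\mid S\Rightarrow^* w\}$. -/

import Mathlib

/-- The equivalence used to encode the letters of words over `N ∪ T` (a disjoint union). -/
def symbolEquiv (T N : Type*) : Symbol T N ≃ T ⊕ N where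
  toFun
    | .terminal t => .inl t
    | .nonterminal A => .inr A
  invFun
    | .inl t => .terminal t
    | .inr A => .nonterminal A
  left_inv s := by cases s <;> rfl
  right_inv s := by cases s <;> rfl

instance instPrimcodableSymbol (T N : Type*) [Primcodable T] [Primcodable N] :
    Primcodable (Symbol T N) :=
  Primcodable.ofEquiv (T ⊕ N) (symbolEquiv T N)

/-- Productions of indexed grammars with terminals in `T`. Nonterminals and index symbols are
named by natural numbers; they are kept apart from each other, and from the terminals, by their
position in the constructors. -/
inductive IndexedProduction (T : Type*) where
  /-- The production `A → w`, with `w` a word over nonterminals and terminals. -/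
  | rewrite (A : ℕ) (w : List (Symbol T ℕ))
  /-- The production `A → B f`, with `f` an index symbol. -/
  | push (A B f : ℕ)
  /-- The production `A f → w`, with `f` an index symbol. -/
  | pop (A f : ℕ) (w : List (Symbol T ℕ))

/-- The equivalence used to encode productions. -/
def indexedProductionEquiv (T : Type*) :
    IndexedProduction T ≃
      (ℕ × List (Symbol T ℕ)) ⊕ (ℕ × ℕ × ℕ) ⊕ (ℕ × ℕ × List (Symbol T ℕ)) where
  toFun
    | .rewrite A w => .inl (A, w)
    | .push A B f => .inr (.inl (A, B, f))
    | .pop A f w => .inr (.inr (A, f, w))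
  invFun
    | .inl (A, w) => .rewrite A w
    | .inr (.inl (A, B, f)) => .push A B f
    | .inr (.inr (A, f, w)) => .pop A f w
  left_inv p := by cases p <;> rfl
  right_inv p := by rcases p with ⟨_, _⟩ | ⟨_, _, _⟩ | ⟨_, _, _⟩ <;> rfl

instance instPrimcodableIndexedProduction (T : Type*) [Primcodable T] :
    Primcodable (IndexedProduction T) :=
  Primcodable.ofEquiv _ (indexedProductionEquiv T)

/-- The tuple `(N, T, I, P, S)` of an indexed grammar with terminal alphabet `T`. The finite sets
`N`, `I`, `P` are given by listing their elements (order and repetitions are irrelevant).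
The conditions `S ∈ N` and `P` uses only symbols of `N`, `T`, `I` are
`IndexedGrammar.WellFormed`. -/
structure IndexedGrammar (T : Type*) where
  /-- The nonterminals `N`. -/
  nonterminals : List ℕ
  /-- The index symbols `I`. -/
  indices : List ℕ
  /-- The productions `P`. -/
  productions : List (IndexedProduction T)
  /-- The start symbol `S`. -/
  start : ℕ

/-- The equivalence used to encode indexed grammars. -/
def indexedGrammarEquiv (T : Type*) :
    IndexedGrammar T ≃ List ℕ × List ℕ × List (IndexedProduction T) × ℕ where
  toFun G := (G.nonterminals, G.indices, G.productions, G.start)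
  invFun c := ⟨c.1, c.2.1, c.2.2.1, c.2.2.2⟩
  left_inv _ := rfl
  right_inv _ := rfl

instance instPrimcodableIndexedGrammar (T : Type*) [Primcodable T] :
    Primcodable (IndexedGrammar T) :=
  Primcodable.ofEquiv _ (indexedGrammarEquiv T)

namespace IndexedGrammar

/-- `w ∈ (N ∪ T)*`. -/
def IsWordOver {T : Type*} (N : List ℕ) (w : List (Symbol T ℕ)) : Prop :=
  ∀ A, Symbol.nonterminal A ∈ w → A ∈ N

/-- The start symbol is a nonterminal of the grammar, and the productions are built from the
nonterminals, terminals and index symbols of the grammar. -/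
def WellFormed {T : Type*} (G : IndexedGrammar T) : Prop :=
  G.start ∈ G.nonterminals ∧
  (∀ A w, IndexedProduction.rewrite A w ∈ G.productions →
    A ∈ G.nonterminals ∧ IsWordOver G.nonterminals w) ∧
  (∀ A B f, IndexedProduction.push A B f ∈ G.productions →
    A ∈ G.nonterminals ∧ B ∈ G.nonterminals ∧ f ∈ G.indices) ∧
  (∀ A f w, IndexedProduction.pop A f w ∈ G.productions →
    A ∈ G.nonterminals ∧ f ∈ G.indices ∧ IsWordOver G.nonterminals w)

/-- Sentential forms, i.e. words in `(N I* ∪ T)*`: each nonterminal carries a stack of index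
symbols, whose topmost symbol is the head of the list. -/
abbrev SententialForm (T : Type*) := List (Symbol T (ℕ × List ℕ))

/-- `[w, x]`: the stack `x` is attached to every nonterminal in `w`. -/
def attach {T : Type*} (w : List (Symbol T ℕ)) (x : List ℕ) : SententialForm T :=
  w.map fun s => match s with
    | .terminal t => .terminal t
    | .nonterminal A => .nonterminal (A, x)

/-- `w ∈ T*`. -/
def IsTerminalWord {T : Type*} (w : List (Symbol T ℕ)) : Prop :=
  ∀ A, Symbol.nonterminal A ∉ w

/-- `G.Rewrites A x r`: the nonterminal `A` with stack `x` can be replaced by `r`. -/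
inductive Rewrites {T : Type*} (G : IndexedGrammar T) :
    ℕ → List ℕ → SententialForm T → Prop
  /-- A production `A → p` with a nonterminal in `p` copies the stack. -/
  | copy {A : ℕ} {p : List (Symbol T ℕ)} (x : List ℕ)
      (h : IndexedProduction.rewrite A p ∈ G.productions) (hp : ¬ IsTerminalWord p) :
      Rewrites G A x (attach p x)
  /-- A production `A → p` with `p ∈ T*` is applicable only when the stack is empty. -/
  | terminal {A : ℕ} {p : List (Symbol T ℕ)}
      (h : IndexedProduction.rewrite A p ∈ G.productions) (hp : IsTerminalWord p) :
      Rewrites G A [] (attach p [])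
  /-- A production `A → B f` pushes `f`. -/
  | push {A B f : ℕ} (x : List ℕ) (h : IndexedProduction.push A B f ∈ G.productions) :
      Rewrites G A x [.nonterminal (B, f :: x)]
  /-- A production `A f → p` pops `f`. -/
  | pop {A f : ℕ} {p : List (Symbol T ℕ)} (y : List ℕ)
      (h : IndexedProduction.pop A f p ∈ G.productions) :
      Rewrites G A (f :: y) (attach p y)

/-- The derivation step relation `q ⇒ r` on sentential forms. -/
def Step {T : Type*} (G : IndexedGrammar T) (q r : SententialForm T) : Prop :=
  ∃ (q₁ q₂ s : SententialForm T) (A : ℕ) (x : List ℕ),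
    G.Rewrites A x s ∧ q = q₁ ++ [.nonterminal (A, x)] ++ q₂ ∧ r = q₁ ++ s ++ q₂

/-- The language generated by `G`: all `w ∈ T*` with `S ⇒* w`. -/
def language {T : Type*} (G : IndexedGrammar T) : Language T :=
  {w | Relation.ReflTransGen G.Step [.nonterminal (G.start, [])] (w.map Symbol.terminal)}

end IndexedGrammar

/-- The language `a* b*`. -/
def aStarBStar {T : Type*} (a b : T) : Language T :=
  {w | ∃ i j : ℕ, w = List.replicate i a ++ List.replicate j b}

/-- The problem "given `x` satisfying `promise x`, does `p x` hold?" is decidable: there is an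
algorithm that halts with the correct answer on every input satisfying the promise (on other
inputs it may answer arbitrarily or fail to halt). -/
def DecidableGiven {α : Type*} [Primcodable α] (promise p : α → Prop) : Prop :=
  ∃ f : α →. Bool, Partrec f ∧
    ∀ x, promise x → ∃ answer : Bool, answer ∈ f x ∧ (answer = true ↔ p x)

/-! The halting problem is reduced to the promise problem. Nondeterministic register programs built
from `zero`, `inc`, `copy`, an equality test, sequencing and iteration compute all partial recursive
functions (`RegProg.realizable_of_partrec'`), so one fixed program `P` has an execution on input `n`
iff the `n`-th code halts on `0`.

An indexed grammar follows the control flow of `P` and pushes every instruction onto the stack,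
without checking any test. At the end the stack is copied to two counters, which read the
instructions backwards in time. For the successive tests `x = y`, one counter produces `∑ (x² + y²)`
letters `a`, the other `∑ 2xy` letters `b`. Since `2xy ≤ x² + y²` with equality only for `x = y`,
the two numbers agree iff every test succeeds (`testSum_le`). Thus the language always lies in
`a*b*`, and it contains some `aⁿbⁿ` iff `P` has an execution.

The counters can be realized by context-free pop productions because each instruction acts on the
registers, extended by a constant `1`, as a matrix over `ℕ`. Products of two entries then transform
linearly as well (`RegCounter.sum_body`), so finitely many counters suffice. The input `n` enters
only through the productions used on the empty stack, which makes the reduction primitive recursive.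
-/

/-! ### Register programs compute all partial recursive functions. -/

/-- Register contents. -/
abbrev RegState := ℕ → ℕ

/-- Atomic instructions of nondeterministic register programs. -/
inductive RegOp where
  | zero (i : ℕ)
  | inc (i : ℕ)
  | copy (i j : ℕ)
  | test (i j : ℕ)
deriving Countable

/-- Nondeterministic register programs. -/
inductive RegProg where
  | op (o : RegOp)
  | seq (p q : RegProg)
  | star (p : RegProg)
deriving Countable

/-- The condition under which an instruction can be executed. -/
def RegOp.Guard : RegOp → RegState → Prop
  | test i j, s => s i = s j
  | _, _ => True

/-- The effect of an instruction on the registers. -/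
def RegOp.act : RegOp → RegState → RegState
  | zero i, s => Function.update s i 0
  | inc i, s => Function.update s i (s i + 1)
  | copy i j, s => Function.update s i (s j)
  | test _ _, s => s

namespace RegProg

/-- The input-output relation of a program. -/
def Exec : RegProg → RegState → RegState → Prop
  | op o => fun s s' => o.Guard s ∧ s' = o.act s
  | seq p q => Relation.Comp (Exec p) (Exec q)
  | star p => Relation.ReflTransGen (Exec p)

/-- Starting with inputs in the registers `ρ`, the program `p` leaves in `r` exactly the values
related to the inputs by `F`; apart from `r` it changes no register below `B`. -/
def Computes {n : ℕ} (p : RegProg) (ρ : Fin n → ℕ) (r B : ℕ)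
    (F : List.Vector ℕ n → ℕ → Prop) : Prop :=
  (∀ s s', p.Exec s s' → (∀ i < B, i ≠ r → s' i = s i) ∧
    F (List.Vector.ofFn fun i => s (ρ i)) (s' r)) ∧
  ∀ s y, F (List.Vector.ofFn fun i => s (ρ i)) y → ∃ s', p.Exec s s' ∧ s' r = y

/-- The relation `F` is computed by a program, for every choice of input and output registers. -/
def Realizable {n : ℕ} (F : List.Vector ℕ n → ℕ → Prop) : Prop :=
  ∀ (ρ : Fin n → ℕ) (r B : ℕ), (∀ i, ρ i < B) → r < B → ∃ p, Computes p ρ r B F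

theorem realizable_zero : Realizable fun (_ : List.Vector ℕ 0) y => y = 0 := by
  intro ρ r B _ _
  refine ⟨op (.zero r), ?_, ?_⟩
  · rintro s s' ⟨-, rfl⟩
    exact ⟨fun i _ hi => by simp [RegOp.act, hi], by simp [RegOp.act]⟩
  · rintro s y rfl
    exact ⟨_, ⟨trivial, rfl⟩, by simp [RegOp.act]⟩

theorem realizable_get {n : ℕ} (k : Fin n) :
    Realizable fun (v : List.Vector ℕ n) y => y = v.get k := by
  intro ρ r B _ _
  refine ⟨op (.copy r (ρ k)), ?_, ?_⟩
  · rintro s s' ⟨-, rfl⟩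
    exact ⟨fun i _ hi => by simp [RegOp.act, hi], by simp [RegOp.act]⟩
  · rintro s y rfl
    exact ⟨_, ⟨trivial, rfl⟩, by simp [RegOp.act]⟩

theorem realizable_succ : Realizable fun (v : List.Vector ℕ 1) y => y = v.head.succ := by
  intro ρ r B _ _
  refine ⟨seq (op (.copy r (ρ 0))) (op (.inc r)), ?_, ?_⟩
  · rintro s s' ⟨_, ⟨-, rfl⟩, -, rfl⟩
    exact ⟨fun i _ hi => by simp [RegOp.act, hi],
      by simp [RegOp.act, ← List.Vector.get_zero]⟩
  · rintro s y rfl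
    exact ⟨_, ⟨_, ⟨trivial, rfl⟩, trivial, rfl⟩, by simp [RegOp.act, ← List.Vector.get_zero]⟩

/-- The arguments of a composition are computed one after another, the `i`-th into the fresh
register `B + i`. -/
theorem exists_prog_forall_lt {m n : ℕ} {G : Fin n → List.Vector ℕ m → ℕ → Prop}
    (hG : ∀ i, Realizable (G i)) (ρ : Fin m → ℕ) (B : ℕ) (hρ : ∀ i, ρ i < B)
    (k : ℕ) (hk : k ≤ n) :
    ∃ p : RegProg,
      (∀ s s', p.Exec s s' → (∀ i < B, s' i = s i) ∧
        ∀ i : Fin n, (i : ℕ) < k → G i (List.Vector.ofFn fun i => s (ρ i)) (s' (B + i))) ∧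
      ∀ s (u : Fin n → ℕ),
        (∀ i : Fin n, (i : ℕ) < k → G i (List.Vector.ofFn fun i => s (ρ i)) (u i)) →
        ∃ s', p.Exec s s' ∧ ∀ i : Fin n, (i : ℕ) < k → s' (B + i) = u i := by
  induction k with
  | zero =>
    -- A test of a register against itself serves as the empty program.
    refine ⟨op (.test 0 0), ?_, fun s u _ => ⟨s, ⟨rfl, rfl⟩, by simp⟩⟩
    rintro s s' ⟨-, rfl⟩
    simp
  | succ k ih =>
    obtain ⟨p, hp, hp'⟩ := ih (by omega)
    -- The bound `B + n` protects the inputs and all results already stored from the scratch work of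
    -- `q`.
    obtain ⟨q, hq, hq'⟩ := hG ⟨k, hk⟩ ρ (B + k) (B + n) (fun i => by have := hρ i; omega) (by omega)
    have key : ∀ s t, p.Exec s t → (fun i => t (ρ i)) = fun i => s (ρ i) := fun s t h =>
      funext fun i => (hp s t h).1 _ (hρ i)
    refine ⟨seq p q, ?_, ?_⟩
    · rintro s s' ⟨t, h₁, h₂⟩
      have e := key _ _ h₁
      obtain ⟨a₁, b₁⟩ := hp _ _ h₁
      obtain ⟨a₂, b₂⟩ := hq _ _ h₂
      refine ⟨fun i hi => by rw [a₂ i (by omega) (by omega), a₁ i hi], fun i hi => ?_⟩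
      rcases Nat.lt_succ_iff_lt_or_eq.1 hi with h | h
      · rw [a₂ _ (by omega) (by omega)]
        exact b₁ i h
      · have : i = ⟨k, hk⟩ := Fin.ext h
        subst this
        rw [e] at b₂
        exact b₂
    · intro s u hu
      obtain ⟨t, h₁, h₁'⟩ := hp' s u fun i hi => hu i (by omega)
      have e := key _ _ h₁
      obtain ⟨s', h₂, h₂'⟩ := hq' t (u ⟨k, hk⟩) (by rw [e]; exact hu _ (by simp))
      refine ⟨s', ⟨t, h₁, h₂⟩, fun i hi => ?_⟩
      rcases Nat.lt_succ_iff_lt_or_eq.1 hi with h | h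
      · rw [(hq _ _ h₂).1 _ (by omega) (by omega), h₁' i h]
      · have : i = ⟨k, hk⟩ := Fin.ext h
        subst this
        exact h₂'

theorem Realizable.comp {m n : ℕ} {F : List.Vector ℕ n → ℕ → Prop}
    {G : Fin n → List.Vector ℕ m → ℕ → Prop} (hF : Realizable F) (hG : ∀ i, Realizable (G i)) :
    Realizable fun v y => ∃ u : Fin n → ℕ, (∀ i, G i v (u i)) ∧ F (List.Vector.ofFn u) y := by
  intro ρ r B hρ hr
  obtain ⟨p, hp, hp'⟩ := exists_prog_forall_lt hG ρ B hρ n le_rfl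
  obtain ⟨q, hq, hq'⟩ := hF (fun i => B + i) r (B + n) (fun i => by omega) (by omega)
  refine ⟨seq p q, ?_, ?_⟩
  · rintro s s' ⟨t, h₁, h₂⟩
    obtain ⟨a₁, b₁⟩ := hp _ _ h₁
    obtain ⟨a₂, b₂⟩ := hq _ _ h₂
    exact ⟨fun i hi hne => by rw [a₂ i (by omega) hne, a₁ i hi], _, fun i => b₁ i i.2, b₂⟩
  · rintro s y ⟨u, hu, hy⟩
    obtain ⟨t, h₁, h₁'⟩ := hp' s u fun i _ => hu i
    have e : (fun i : Fin n => t (B + i)) = u := funext fun i => h₁' i i.2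
    obtain ⟨s', h₂, h₂'⟩ := hq' t y (by rw [e]; exact hy)
    exact ⟨s', ⟨t, h₁, h₂⟩, h₂'⟩

theorem ofFn_succ_eq_cons {n : ℕ} (f : Fin (n + 1) → ℕ) :
    List.Vector.ofFn f = f 0 ::ᵥ List.Vector.ofFn fun i => f i.succ := rfl

/-- Register `B` holds the recursion index and `B + 1` the value reached so far; the loop invariant
is that `B + 1` contains the recursively defined value at index `B`. -/
theorem realizable_prec {n : ℕ} {f : List.Vector ℕ n → ℕ} {g : List.Vector ℕ (n + 2) → ℕ}
    (hf : Realizable fun v y => y = f v) (hg : Realizable fun v y => y = g v) :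
    Realizable fun (v : List.Vector ℕ (n + 1)) y =>
      y = v.head.rec (f v.tail) fun y IH => g (y ::ᵥ IH ::ᵥ v.tail) := by
  intro ρ r B hρ hr
  obtain ⟨p, hp, hp'⟩ := hf (fun i => ρ i.succ) (B + 1) (B + 2)
    (fun i => by have := hρ i.succ; omega) (by omega)
  obtain ⟨q, hq, hq'⟩ := hg (Fin.cons B (Fin.cons (B + 1) fun i => ρ i.succ)) (B + 1) (B + 2)
    (by
      refine Fin.cases (by simp) (Fin.cases (by simp) fun i => ?_)
      have := hρ i.succ
      simp only [Fin.cons_succ]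
      omega) (by omega)
  simp only [ofFn_succ_eq_cons, Fin.cons_zero, Fin.cons_succ] at hq hq'
  simp only [Computes, ofFn_succ_eq_cons, List.Vector.head_cons, List.Vector.tail_cons]
  set R : RegState → ℕ → ℕ := fun s k => Nat.rec (f (List.Vector.ofFn fun i => s (ρ i.succ)))
    (fun y IH => g (y ::ᵥ IH ::ᵥ List.Vector.ofFn fun i => s (ρ i.succ))) k with hR
  have inputs : ∀ s t : RegState, (∀ i < B, t i = s i) →
      (fun i : Fin n => t (ρ i.succ)) = fun i => s (ρ i.succ) := fun s t h =>
    funext fun i => h _ (hρ _)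
  have Rcongr : ∀ s t : RegState, (∀ i < B, t i = s i) → R t = R s := fun s t h => by
    funext k
    simp only [hR, inputs s t h]
  have loop : ∀ s t, (star (seq q (op (.inc B)))).Exec s t → s (B + 1) = R s (s B) →
      (∀ i < B, t i = s i) ∧ t (B + 1) = R s (t B) := by
    intro s t h h₀
    induction h with
    | refl => exact ⟨fun _ _ => rfl, h₀⟩
    | tail _ hstep ih =>
      obtain ⟨ih₁, ih₂⟩ := ih
      obtain ⟨u, hu, -, rfl⟩ := hstep
      obtain ⟨a, b⟩ := hq _ _ hu
      refine ⟨fun i hi => ?_, ?_⟩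
      · have : i ≠ B := by omega
        simp [RegOp.act, this, a i (by omega) (by omega), ih₁ i hi]
      · simp [RegOp.act, b, a B (by omega) (by omega), ih₂, inputs _ _ ih₁, hR]
  have run : ∀ (s : RegState) (k : ℕ), s B = 0 →
      ∃ t, (star (seq q (op (.inc B)))).Exec s t ∧ t B = k := by
    intro s k h₀
    induction k with
    | zero => exact ⟨s, .refl, h₀⟩
    | succ k ih =>
      obtain ⟨t, ht, htk⟩ := ih
      obtain ⟨u, hu, -⟩ := hq' t _ rfl
      exact ⟨_, ht.tail ⟨u, hu, trivial, rfl⟩,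
        by simp [RegOp.act, (hq _ _ hu).1 B (by omega) (by omega), htk]⟩
  -- The loop runs an arbitrary number of times; the test after it keeps only the executions in
  -- which this number is the recursion argument.
  refine ⟨seq p (seq (op (.zero B)) (seq (star (seq q (op (.inc B))))
    (seq (op (.test B (ρ 0))) (op (.copy r (B + 1)))))), ?_, ?_⟩
  · rintro s s' ⟨t, h₁, _, ⟨-, rfl⟩, _, h₃, u, ⟨h₄, rfl⟩, -, rfl⟩
    obtain ⟨a₁, b₁⟩ := hp _ _ h₁
    have c : ∀ i < B, (RegOp.zero B).act t i = s i := fun i hi => by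
      have : i ≠ B := by omega
      simp [RegOp.act, this, a₁ i (by omega) (by omega)]
    obtain ⟨a₃, b₃⟩ := loop _ _ h₃ (by
      rw [Rcongr _ _ c]
      simp [RegOp.act, b₁, hR])
    refine ⟨fun i hi hne => ?_, ?_⟩
    · simpa [RegOp.act, hne] using (a₃ i hi).trans (c i hi)
    · have h₅ : u B = s (ρ 0) := by
        rw [show u B = u (ρ 0) from h₄, a₃ _ (hρ 0), c _ (hρ 0)]
      rw [Rcongr _ _ c, h₅] at b₃
      simp only [RegOp.act, Function.update_self, b₃]
      rfl
  · rintro s y rfl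
    obtain ⟨t, h₁, e₁⟩ := hp' s _ rfl
    obtain ⟨a₁, b₁⟩ := hp _ _ h₁
    have c : ∀ i < B, (RegOp.zero B).act t i = s i := fun i hi => by
      have : i ≠ B := by omega
      simp [RegOp.act, this, a₁ i (by omega) (by omega)]
    obtain ⟨u, h₃, e₃⟩ := run ((RegOp.zero B).act t) (s (ρ 0)) (by simp [RegOp.act])
    obtain ⟨a₃, b₃⟩ := loop _ _ h₃ (by
      rw [Rcongr _ _ c]
      simp [RegOp.act, b₁, hR])
    refine ⟨_, ⟨t, h₁, _, ⟨trivial, rfl⟩, u, h₃, _, ⟨?_, rfl⟩, trivial, rfl⟩, ?_⟩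
    · change u B = u (ρ 0)
      rw [e₃, a₃ _ (hρ 0), c _ (hρ 0)]
    · rw [Rcongr _ _ c, e₃] at b₃
      simp only [RegOp.act, Function.update_self, b₃]
      rfl

theorem realizable_of_primrec' {n : ℕ} {f : List.Vector ℕ n → ℕ} (hf : Nat.Primrec' f) :
    Realizable fun v y => y = f v := by
  induction hf with
  | zero => exact realizable_zero
  | succ => exact realizable_succ
  | get i => exact realizable_get i
  | comp g _ _ ihf ihg =>
    convert ihf.comp ihg using 3 with v y
    constructor
    · rintro rfl
      exact ⟨_, fun i => rfl, rfl⟩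
    · rintro ⟨u, hu, rfl⟩
      rw [funext hu]
  | prec _ _ ihf ihg => exact realizable_prec ihf ihg

/-- The candidate in register `B` may be increased only when the value of `f` there is nonzero. As
only equality can be tested, nonvanishing is certified by guessing a positive number in `B + 2` and
comparing it with the value in `B + 1`. -/
theorem realizable_rfind {n : ℕ} {f : List.Vector ℕ (n + 1) → ℕ}
    (hf : Realizable fun v y => y = f v) :
    Realizable fun (v : List.Vector ℕ n) y =>
      f (y ::ᵥ v) = 0 ∧ ∀ k < y, f (k ::ᵥ v) ≠ 0 := by
  intro ρ r B hρ hr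
  obtain ⟨q, hq, hq'⟩ := hf (Fin.cons B fun i => ρ i) (B + 1) (B + 3)
    (by
      refine Fin.cases (by simp) fun i => ?_
      have := hρ i
      simp only [Fin.cons_succ]
      omega) (by omega)
  simp only [ofFn_succ_eq_cons, Fin.cons_zero, Fin.cons_succ] at hq hq'
  have inputs : ∀ s t : RegState, (∀ i < B, t i = s i) →
      (fun i : Fin n => t (ρ i)) = fun i => s (ρ i) := fun s t h =>
    funext fun i => h _ (hρ _)
  have grow : ∀ s t, (star (op (.inc (B + 2)))).Exec s t →
      (∀ i ≠ B + 2, t i = s i) ∧ s (B + 2) ≤ t (B + 2) := by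
    intro s t h
    induction h with
    | refl => exact ⟨fun _ _ => rfl, le_rfl⟩
    | tail _ hstep ih =>
      obtain ⟨-, rfl⟩ := hstep
      refine ⟨fun i hi => by simp [RegOp.act, hi, ih.1 i hi], ?_⟩
      simp only [RegOp.act, Function.update_self]
      omega
  have grow' : ∀ (s : RegState) (k : ℕ), ∃ t, (star (op (.inc (B + 2)))).Exec s t ∧
      t (B + 2) = s (B + 2) + k := by
    intro s k
    induction k with
    | zero => exact ⟨s, .refl, rfl⟩
    | succ k ih =>
      obtain ⟨t, ht, htk⟩ := ih
      exact ⟨_, ht.tail ⟨trivial, rfl⟩, by simp [RegOp.act, htk, add_assoc]⟩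
  set body := seq q (seq (op (.zero (B + 2))) (seq (op (.inc (B + 2)))
    (seq (star (op (.inc (B + 2)))) (seq (op (.test (B + 1) (B + 2))) (op (.inc B)))))) with hbody
  have step : ∀ s t, body.Exec s t → (∀ i < B, t i = s i) ∧ t B = s B + 1 ∧
      f (s B ::ᵥ List.Vector.ofFn fun i => s (ρ i)) ≠ 0 := by
    rintro s t ⟨u, h₁, _, ⟨-, rfl⟩, _, ⟨-, rfl⟩, _, h₂, v, ⟨h₃, rfl⟩, -, rfl⟩
    obtain ⟨a₁, b₁⟩ := hq _ _ h₁
    obtain ⟨a₂, b₂⟩ := grow _ _ h₂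
    have c : ∀ i < B + 2, v i = u i := fun i hi => by
      have : i ≠ B + 2 := by omega
      rw [a₂ i this]
      simp [RegOp.act, this]
    refine ⟨fun i hi => ?_, ?_, ?_⟩
    · have : i ≠ B := by omega
      simp [RegOp.act, this, c i (by omega), a₁ i (by omega) (by omega)]
    · simp [RegOp.act, c B (by omega), a₁ B (by omega) (by omega)]
    · have h₄ : v (B + 1) = v (B + 2) := h₃
      simp only [RegOp.act, Function.update_self] at b₂
      rw [← b₁, ← c _ (by omega)]
      omega
  have step' : ∀ s : RegState, f (s B ::ᵥ List.Vector.ofFn fun i => s (ρ i)) ≠ 0 →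
      ∃ t, body.Exec s t := by
    intro s hs
    obtain ⟨u, h₁, e₁⟩ := hq' s _ rfl
    -- One `inc` is always executed before the loop, hence the `- 1`.
    obtain ⟨v, h₂, e₂⟩ := grow' ((RegOp.inc (B + 2)).act ((RegOp.zero (B + 2)).act u))
      (u (B + 1) - 1)
    refine ⟨_, u, h₁, _, ⟨trivial, rfl⟩, _, ⟨trivial, rfl⟩, v, h₂, _, ⟨?_, rfl⟩, trivial, rfl⟩
    change v (B + 1) = v (B + 2)
    rw [(grow _ _ h₂).1 _ (by omega), e₂]
    simp only [RegOp.act, Function.update_self, ne_eq, not_false_eq_true, Function.update_of_ne,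
      show B + 1 ≠ B + 2 by omega]
    omega
  have loop : ∀ s t, (star body).Exec s t → s B = 0 → (∀ i < B, t i = s i) ∧
      ∀ k < t B, f (k ::ᵥ List.Vector.ofFn fun i => s (ρ i)) ≠ 0 := by
    intro s t h h₀
    induction h with
    | refl => exact ⟨fun _ _ => rfl, by omega⟩
    | tail _ hstep ih =>
      obtain ⟨a, b, c⟩ := step _ _ hstep
      refine ⟨fun i hi => by rw [a i hi, ih.1 i hi], fun k hk => ?_⟩
      rw [b] at hk
      rcases Nat.lt_succ_iff_lt_or_eq.1 hk with h | rfl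
      · exact ih.2 k h
      · rwa [inputs _ _ ih.1] at c
  have run : ∀ (s : RegState) (k : ℕ), s B = 0 →
      (∀ j < k, f (j ::ᵥ List.Vector.ofFn fun i => s (ρ i)) ≠ 0) →
      ∃ t, (star body).Exec s t ∧ t B = k := by
    intro s k h₀
    induction k with
    | zero => exact fun _ => ⟨s, .refl, h₀⟩
    | succ k ih =>
      intro hk
      obtain ⟨t, ht, htk⟩ := ih fun j hj => hk j (by omega)
      obtain ⟨u, hu⟩ := step' t (by
        rw [htk, inputs _ _ (loop _ _ ht h₀).1]
        exact hk k (by omega))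
      exact ⟨u, ht.tail hu, by rw [(step _ _ hu).2.1, htk]⟩
  -- After the loop `f` is evaluated once more, and the result must equal the zero in `B + 2`.
  refine ⟨seq (op (.zero B)) (seq (star body) (seq q (seq (op (.zero (B + 2)))
    (seq (op (.test (B + 1) (B + 2))) (op (.copy r B)))))), ?_, ?_⟩
  · rintro s s' ⟨_, ⟨-, rfl⟩, t, h₁, u, h₂, _, ⟨-, rfl⟩, _, ⟨h₃, rfl⟩, -, rfl⟩
    have c : ∀ i < B, (RegOp.zero B).act s i = s i := fun i hi => by
      have : i ≠ B := by omega
      simp [RegOp.act, this]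
    obtain ⟨a₁, b₁⟩ := loop _ _ h₁ (by simp [RegOp.act])
    obtain ⟨a₂, b₂⟩ := hq _ _ h₂
    rw [inputs _ _ c] at b₁
    rw [inputs _ _ a₁, inputs _ _ c] at b₂
    have h₄ : u (B + 1) = 0 := by
      simpa [RegOp.act, RegOp.Guard] using h₃
    have h₅ : (RegOp.copy r B).act ((RegOp.test (B + 1) (B + 2)).act
        ((RegOp.zero (B + 2)).act u)) r = t B := by
      simp [RegOp.act, a₂ B (by omega) (by omega)]
    refine ⟨fun i hi hne => ?_, ?_, ?_⟩
    · have : i ≠ B + 2 := by omega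
      simp [RegOp.act, hne, this, a₂ i (by omega) (by omega), a₁ i hi, show i ≠ B by omega]
    · rw [h₅, ← b₂, h₄]
    · rwa [h₅]
  · rintro s y ⟨hy, hlt⟩
    have c : ∀ i < B, (RegOp.zero B).act s i = s i := fun i hi => by
      have : i ≠ B := by omega
      simp [RegOp.act, this]
    obtain ⟨t, h₁, e₁⟩ := run ((RegOp.zero B).act s) y (by simp [RegOp.act])
      (by rwa [inputs _ _ c])
    obtain ⟨a₁, -⟩ := loop _ _ h₁ (by simp [RegOp.act])
    obtain ⟨u, h₂, e₂⟩ := hq' t _ rfl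
    obtain ⟨a₂, -⟩ := hq _ _ h₂
    rw [inputs _ _ a₁, inputs _ _ c, e₁, hy] at e₂
    refine ⟨_, ⟨_, ⟨trivial, rfl⟩, t, h₁, u, h₂, _, ⟨trivial, rfl⟩, _, ⟨?_, rfl⟩, trivial, rfl⟩, ?_⟩
    · simp [RegOp.act, RegOp.Guard, e₂]
    · simp [RegOp.act, a₂ B (by omega) (by omega), e₁]

theorem mem_mOfFn_part_iff {α : Type*} {n : ℕ} (f : Fin n → Part α) (v : List.Vector α n) :
    v ∈ List.Vector.mOfFn f ↔ ∀ i, v.get i ∈ f i := by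
  induction n with
  | zero =>
    simp only [List.Vector.mOfFn, Part.pure_eq_some, Part.mem_some_iff, IsEmpty.forall_iff, iff_true]
    exact List.Vector.eq_nil v
  | succ n ih =>
    simp only [List.Vector.mOfFn, Part.bind_eq_bind, Part.mem_bind_iff, Part.pure_eq_some,
      Part.mem_some_iff, ih, Fin.forall_fin_succ]
    constructor
    · rintro ⟨a, ha, w, hw, rfl⟩
      exact ⟨by simpa using ha, by simpa using hw⟩
    · rintro ⟨h₀, hs⟩
      exact ⟨v.head, by simpa using h₀, v.tail, by simpa using hs, by simp⟩

theorem realizable_of_partrec' {n : ℕ} {f : List.Vector ℕ n →. ℕ} (hf : Nat.Partrec' f) :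
    Realizable fun v y => y ∈ f v := by
  induction hf with
  | prim h =>
    simpa [PFun.coe_val, Part.mem_some_iff] using realizable_of_primrec' h
  | comp g _ _ ihf ihg =>
    refine cast (congrArg Realizable ?_) (ihf.comp ihg)
    funext v y
    refine propext (Iff.trans ?_ Part.mem_bind_iff.symm)
    simp only [mem_mOfFn_part_iff]
    constructor
    · rintro ⟨u, hu, hy⟩
      exact ⟨_, by simpa using hu, hy⟩
    · rintro ⟨u, hu, hy⟩
      exact ⟨u.get, hu, by simpa using hy⟩
  | rfind _ ih =>
    convert realizable_rfind (by simpa [PFun.coe_val, Part.mem_some_iff] using ih) using 3 with v y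
    refine Nat.mem_rfind.trans ?_
    simp

end RegProg

/-! ### Executions as words of instructions, with control flow separated from tests. -/

/-- Register contents after the instructions `w`, the most recent of which is the head. -/
def regVal (s₀ : RegState) : List RegOp → RegState
  | [] => s₀
  | o :: w => o.act (regVal s₀ w)

/-- All instructions of `w` (the most recent of which is the head) can be executed. -/
def LegalRun (s₀ : RegState) : List RegOp → Prop
  | [] => True
  | o :: w => o.Guard (regVal s₀ w) ∧ LegalRun s₀ w

/-- The control flow of programs. A control state lists the programs still to be executed. -/
inductive CtlStep : List RegProg × List RegOp → List RegProg × List RegOp → Prop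
  | op (o : RegOp) (K : List RegProg) (w : List RegOp) : CtlStep (.op o :: K, w) (K, o :: w)
  | seq (p q : RegProg) (K : List RegProg) (w : List RegOp) :
      CtlStep (.seq p q :: K, w) (p :: q :: K, w)
  | skip (p : RegProg) (K : List RegProg) (w : List RegOp) : CtlStep (.star p :: K, w) (K, w)
  | loop (p : RegProg) (K : List RegProg) (w : List RegOp) :
      CtlStep (.star p :: K, w) (p :: .star p :: K, w)

namespace RegProg

/-- The input-output relation of the successive execution of several programs. -/
def ExecList : List RegProg → RegState → RegState → Prop
  | [] => Eq
  | p :: K => Relation.Comp (Exec p) (ExecList K)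

theorem exists_ctlStep_of_exec {s₀ : RegState} {p : RegProg} : ∀ {s s' : RegState},
    p.Exec s s' → ∀ (K : List RegProg) (w : List RegOp), regVal s₀ w = s → LegalRun s₀ w →
    ∃ w', Relation.ReflTransGen CtlStep (p :: K, w) (K, w') ∧ regVal s₀ w' = s' ∧
      LegalRun s₀ w' := by
  induction p with
  | op o =>
    rintro s s' ⟨h, rfl⟩ K w rfl hw
    exact ⟨o :: w, .single (.op o K w), rfl, h, hw⟩
  | seq p q ihp ihq =>
    rintro s s' ⟨t, h₁, h₂⟩ K w hs hw
    obtain ⟨w₁, r₁, hs₁, hw₁⟩ := ihp h₁ (q :: K) w hs hw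
    obtain ⟨w₂, r₂, hs₂, hw₂⟩ := ihq h₂ K w₁ hs₁ hw₁
    exact ⟨w₂, .head (.seq p q K w) (r₁.trans r₂), hs₂, hw₂⟩
  | star p ih =>
    intro s s' h K w hs hw
    -- Each pass of the loop returns to the control state `star p :: K`; a single `skip` leaves it
    -- at the end.
    suffices ∃ w', Relation.ReflTransGen CtlStep (star p :: K, w) (star p :: K, w') ∧
        regVal s₀ w' = s' ∧ LegalRun s₀ w' by
      obtain ⟨w', r, h'⟩ := this
      exact ⟨w', r.tail (.skip p K w'), h'⟩
    induction h with
    | refl => exact ⟨w, .refl, hs, hw⟩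
    | tail _ hstep ih' =>
      obtain ⟨w₁, r₁, hs₁, hw₁⟩ := ih'
      obtain ⟨w₂, r₂, h₂⟩ := ih hstep (star p :: K) w₁ hs₁ hw₁
      exact ⟨w₂, (r₁.tail (.loop p K w₁)).trans r₂, h₂⟩

/-- Control steps ignore the guards. Legality of the final word supplies them all, since every
earlier word is a suffix of it. -/
theorem execList_of_ctlStep {s₀ : RegState} {c : List RegProg × List RegOp} {w' : List RegOp}
    (h : Relation.ReflTransGen CtlStep c ([], w')) (hw' : LegalRun s₀ w') :
    LegalRun s₀ c.2 ∧ ExecList c.1 (regVal s₀ c.2) (regVal s₀ w') := by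
  induction h using Relation.ReflTransGen.head_induction_on with
  | refl => exact ⟨hw', rfl⟩
  | head hstep _ ih =>
    obtain ⟨ih₁, ih₂⟩ := ih
    cases hstep with
    | op o K w => exact ⟨ih₁.2, _, ⟨ih₁.1, rfl⟩, ih₂⟩
    | seq p q K w =>
      obtain ⟨t, h₁, u, h₂, h₃⟩ := ih₂
      exact ⟨ih₁, u, ⟨t, h₁, h₂⟩, h₃⟩
    | skip p K w => exact ⟨ih₁, _, .refl, ih₂⟩
    | loop p K w =>
      obtain ⟨t, h₁, u, h₂, h₃⟩ := ih₂
      exact ⟨ih₁, u, .head h₁ h₂, h₃⟩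

theorem exists_exec_iff (p : RegProg) (s₀ : RegState) :
    (∃ s', p.Exec s₀ s') ↔
      ∃ w, Relation.ReflTransGen CtlStep ([p], []) ([], w) ∧ LegalRun s₀ w := by
  constructor
  · rintro ⟨s', h⟩
    obtain ⟨w, h₁, -, h₂⟩ := exists_ctlStep_of_exec (s₀ := s₀) h [] [] rfl trivial
    exact ⟨w, h₁, h₂⟩
  · rintro ⟨w, h₁, h₂⟩
    obtain ⟨-, t, h, -⟩ := execList_of_ctlStep h₁ h₂
    exact ⟨t, h⟩

/-- The control states that occur in the execution of `p` before the control state `K`. -/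
def support : RegProg → List RegProg → List (List RegProg)
  | op o, K => [op o :: K]
  | seq p q, K => (seq p q :: K) :: (support p (q :: K) ++ support q K)
  | star p, K => (star p :: K) :: support p (star p :: K)

theorem cons_mem_support (p : RegProg) (K : List RegProg) : p :: K ∈ support p K := by
  cases p <;> simp [support]

/-- This yields finiteness of the set of control states. The exit state `K` is kept apart so that,
for `seq p q`, leaving `p` means entering the support of `q`. -/
theorem support_closed {p : RegProg} : ∀ {K : List RegProg} {c c' : List RegProg × List RegOp},
    CtlStep c c' → c.1 ∈ support p K → c'.1 ∈ support p K ∨ c'.1 = K := by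
  induction p with
  | op o =>
    intro K c c' h hc
    cases h <;> simp_all [support]
  | seq p q ihp ihq =>
    intro K c c' h hc
    simp only [support, List.mem_cons, List.mem_append] at hc ⊢
    rcases hc with hc | hc | hc
    · cases h <;> simp_all [cons_mem_support]
    · rcases ihp h hc with h' | h'
      · simp [h']
      · simp [h', cons_mem_support]
    · rcases ihq h hc with h' | h' <;> simp [h']
  | star p ih =>
    intro K c c' h hc
    simp only [support, List.mem_cons] at hc ⊢
    rcases hc with hc | hc
    · cases h <;> simp_all [cons_mem_support]
    · rcases ih h hc with h' | h' <;> simp [h']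

end RegProg

/-! ### Tests as quadratic sums, and the counters that evaluate them. -/

/-- Sum over the tests `x = y` of `w` of the values `x² + y²` (for `false`) or `2xy`
(for `true`). -/
def testSum (s₀ : RegState) (c : Bool) : List RegOp → ℕ
  | [] => 0
  | .test i j :: w =>
    (bif c then regVal s₀ w i * regVal s₀ w j + regVal s₀ w i * regVal s₀ w j
      else regVal s₀ w i * regVal s₀ w i + regVal s₀ w j * regVal s₀ w j) + testSum s₀ c w
  | _ :: w => testSum s₀ c w

/-- Each test contributes a difference of `(x - y)²`. The inequality is carried through the
induction because equality of the sums forces equality term by term only when no term can compensate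
another. -/
theorem testSum_le (s₀ : RegState) (w : List RegOp) :
    testSum s₀ true w ≤ testSum s₀ false w ∧
      (testSum s₀ false w = testSum s₀ true w ↔ LegalRun s₀ w) := by
  induction w with
  | nil => simp [testSum, LegalRun]
  | cons o w ih =>
    obtain ⟨ih₁, ih₂⟩ := ih
    cases o with
    | test i j =>
      simp only [testSum, LegalRun, RegOp.Guard, cond_true, cond_false, ← ih₂]
      generalize regVal s₀ w i = x
      generalize regVal s₀ w j = y
      have h : x * y + x * y ≤ x * x + y * y := by
        rcases le_total x y with h | h <;> obtain ⟨d, rfl⟩ := Nat.exists_eq_add_of_le h <;> nlinarith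
      refine ⟨by omega, ⟨fun h' => ?_, fun ⟨h₁, h₂⟩ => by subst h₁; omega⟩⟩
      have h'' : x * x + y * y = x * y + x * y := by omega
      refine ⟨?_, by omega⟩
      have : ((x : ℤ) - y) ^ 2 = 0 := by
        zify at h''
        linarith
      have := pow_eq_zero_iff (two_ne_zero) |>.1 this
      omega
    | _ => simpa [testSum, LegalRun, RegOp.Guard] using ⟨ih₁, ih₂⟩

/-- Register values, extended by the constant `1`. -/
def extVal (s : RegState) : Option ℕ → ℕ
  | none => 1
  | some i => s i

/-- The entries whose sum is the value of an entry after the given instruction. -/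
def RegOp.row : RegOp → Option ℕ → List (Option ℕ)
  | _, none => [none]
  | zero i, some k => if k = i then [] else [some k]
  | inc i, some k => if k = i then [some k, none] else [some k]
  | copy i j, some k => if k = i then [some j] else [some k]
  | test _ _, some k => [some k]

/-- The constant entry `1` turns the affine action of `inc` into a linear one. -/
theorem RegOp.sum_row (o : RegOp) (s : RegState) (k : Option ℕ) :
    ((o.row k).map (extVal s)).sum = extVal (o.act s) k := by
  cases k with
  | none => cases o <;> simp [row, extVal]
  | some k =>
    cases o <;> simp only [row, act]
    case zero i => by_cases h : k = i <;> simp [h, extVal]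
    case inc i => by_cases h : k = i <;> simp [h, extVal]
    case copy i _ => by_cases h : k = i <;> simp [h, extVal]
    case test i => simp [extVal]

/-- The quantities counted by the grammar: the accumulated tests, and products of entries. -/
inductive RegCounter where
  | acc
  | mul (i j : Option ℕ)
deriving Countable

namespace RegCounter

/-- The value of a counter. -/
def count (s₀ : RegState) (c : Bool) : RegCounter → List RegOp → ℕ
  | acc, w => testSum s₀ c w
  | mul i j, w => extVal (regVal s₀ w) i * extVal (regVal s₀ w) j

/-- The counters whose sum is the value of a counter after the given instruction. -/
def body (c : Bool) : RegCounter → RegOp → List RegCounter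
  | acc, .test i j =>
    (bif c then [mul (some i) (some j), mul (some i) (some j)]
      else [mul (some i) (some i), mul (some j) (some j)]) ++ [acc]
  | acc, _ => [acc]
  | mul i j, o => (o.row i).flatMap fun k => (o.row j).map fun l => mul k l

/-- For a product counter this is the expansion of a product of two row sums. It is the identity
that makes a pop production correct. -/
theorem sum_body (s₀ : RegState) (c : Bool) (X : RegCounter) (o : RegOp) (w : List RegOp) :
    ((X.body c o).map fun Y => Y.count s₀ c w).sum = X.count s₀ c (o :: w) := by
  cases X with
  | acc =>
    cases o with
    | test i j => cases c <;> simp [body, count, testSum, extVal, add_assoc]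
    | _ => simp [body, count, testSum]
  | mul i j =>
    simp only [body, count, regVal, ← RegOp.sum_row]
    generalize o.row i = L
    generalize o.row j = M
    induction L with
    | nil => simp
    | cons k L ih =>
      simp only [List.flatMap_cons, List.map_append, List.sum_append, ih, List.map_cons,
        List.sum_cons, add_mul]
      congr 1
      simp [Function.comp_def, List.sum_map_mul_left]

end RegCounter

/-! ### Productions of the simulating grammar, and soundness of derivations. -/

/-- Nonterminals of the grammar that simulates a program: control states, and counters that
produce the first or the second letter. -/
inductive RegNonterminal where
  | ctl (K : List RegProg)
  | cnt (c : Bool) (X : RegCounter)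
deriving Countable

/-- The names of nonterminals. -/
noncomputable def ntCode : RegNonterminal → ℕ :=
  (exists_injective_nat RegNonterminal).choose

theorem ntCode_injective : Function.Injective ntCode :=
  (exists_injective_nat RegNonterminal).choose_spec

/-- The names of index symbols. -/
noncomputable def opCode : RegOp → ℕ :=
  (exists_injective_nat RegOp).choose

theorem opCode_injective : Function.Injective opCode :=
  (exists_injective_nat RegOp).choose_spec

instance : Nonempty RegNonterminal := ⟨.ctl []⟩

instance : Nonempty RegOp := ⟨.zero 0⟩

/-- The nonterminal with a given name. -/
noncomputable def ntDecode : ℕ → RegNonterminal := Function.invFun ntCode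

/-- The instruction with a given name. -/
noncomputable def opDecode : ℕ → RegOp := Function.invFun opCode

@[simp] theorem ntDecode_ntCode (X : RegNonterminal) : ntDecode (ntCode X) = X :=
  Function.leftInverse_invFun ntCode_injective X

@[simp] theorem opDecode_opCode (o : RegOp) : opDecode (opCode o) = o :=
  Function.leftInverse_invFun opCode_injective o

section Grammar

variable {T : Type*} (a b : T) (s₀ : RegState)

/-- The occurrence of a nonterminal in the right-hand side of a production. -/
noncomputable def ntSymbol (X : RegNonterminal) : Symbol T ℕ := .nonterminal (ntCode X)

/-- The productions of a control state. -/
noncomputable def ctlProductions : List RegProg → List (IndexedProduction T)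
  | [] => [.rewrite (ntCode (.ctl [])) [ntSymbol (.cnt false .acc), ntSymbol (.cnt true .acc)]]
  | .op o :: K => [.push (ntCode (.ctl (.op o :: K))) (ntCode (.ctl K)) (opCode o)]
  | .seq p q :: K => [.rewrite (ntCode (.ctl (.seq p q :: K))) [ntSymbol (.ctl (p :: q :: K))]]
  | .star p :: K => [.rewrite (ntCode (.ctl (.star p :: K))) [ntSymbol (.ctl K)],
      .rewrite (ntCode (.ctl (.star p :: K))) [ntSymbol (.ctl (p :: .star p :: K))]]

/-- The production by which a counter removes the most recent instruction. -/
noncomputable def popProduction (c : Bool) (X : RegCounter) (o : RegOp) : IndexedProduction T :=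
  .pop (ntCode (.cnt c X)) (opCode o) ((X.body c o).map fun Y => ntSymbol (.cnt c Y))

/-- The production by which a counter outputs its initial value. -/
noncomputable def bottomProduction (c : Bool) (X : RegCounter) : IndexedProduction T :=
  .rewrite (ntCode (.cnt c X)) (List.replicate (X.count s₀ c []) (.terminal (bif c then b else a)))

/-- The words generated from a nonterminal with a given stack. -/
def RegNonterminal.words : RegNonterminal → List RegOp → Language T
  | ctl K, w => {u | ∃ w', Relation.ReflTransGen CtlStep (K, w) ([], w') ∧
      u = List.replicate (testSum s₀ false w') a ++ List.replicate (testSum s₀ true w') b}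
  | cnt c X, w => {List.replicate (X.count s₀ c w) (bif c then b else a)}

/-- The words generated from a symbol of a sentential form. -/
noncomputable def symbolWords : Symbol T (ℕ × List ℕ) → Language T
  | .terminal t => {[t]}
  | .nonterminal (A, x) => (ntDecode A).words a b s₀ (x.map opDecode)

/-- The words generated from a sentential form. -/
noncomputable def formWords (q : IndexedGrammar.SententialForm T) : Language T :=
  (q.map (symbolWords a b s₀)).prod

theorem formWords_append (q r : IndexedGrammar.SententialForm T) :
    formWords a b s₀ (q ++ r) = formWords a b s₀ q * formWords a b s₀ r := by
  simp [formWords]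

theorem formWords_singleton (s : Symbol T (ℕ × List ℕ)) :
    formWords a b s₀ [s] = symbolWords a b s₀ s := by
  simp [formWords]

theorem language_singleton_mul (u v : List T) :
    ({u} : Language T) * {v} = {u ++ v} := by
  ext w
  simp only [Language.mem_mul]
  constructor
  · rintro ⟨_, rfl, _, rfl, rfl⟩
    rfl
  · rintro rfl
    exact ⟨u, rfl, v, rfl, rfl⟩

theorem formWords_terminals (u : List T) :
    formWords a b s₀ (u.map .terminal) = {u} := by
  induction u with
  | nil => rfl
  | cons t u ih =>
    rw [List.map_cons, ← List.singleton_append, formWords_append, ih]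
    simp [formWords_singleton, symbolWords, language_singleton_mul]

theorem attach_map_ntSymbol {α : Type*} (f : α → RegNonterminal) (L : List α) (x : List ℕ) :
    IndexedGrammar.attach (L.map fun Y => ntSymbol (T := T) (f Y)) x =
      L.map fun Y => .nonterminal (ntCode (f Y), x) := by
  simp [IndexedGrammar.attach, ntSymbol]

theorem attach_replicate_terminal (n : ℕ) (t : T) (x : List ℕ) :
    IndexedGrammar.attach (List.replicate n (.terminal t)) x =
      (List.replicate n t).map .terminal := by
  simp [IndexedGrammar.attach]

theorem formWords_counters (c : Bool) (L : List RegCounter) (x : List ℕ) :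
    formWords a b s₀ (L.map fun Y => .nonterminal (ntCode (.cnt c Y), x)) =
      {List.replicate (L.map fun Y => Y.count s₀ c (x.map opDecode)).sum (bif c then b else a)} := by
  induction L with
  | nil => rfl
  | cons Y L ih =>
    rw [List.map_cons, ← List.singleton_append, formWords_append, ih]
    simp [formWords_singleton, symbolWords, RegNonterminal.words, language_singleton_mul]

variable {a b s₀}

/-- The intended language of a sentential form can only shrink: control productions mirror
`CtlStep`, pop productions preserve it by `RegCounter.sum_body`, and bottom productions output
exactly the initial value. -/
theorem formWords_le_of_rewrites {G : IndexedGrammar T}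
    (hG : ∀ π ∈ G.productions, (∃ K, π ∈ ctlProductions K) ∨
      (∃ c X o, π = popProduction c X o) ∨ ∃ c X, π = bottomProduction a b s₀ c X)
    {A : ℕ} {x : List ℕ} {r : IndexedGrammar.SententialForm T} (h : G.Rewrites A x r) :
    formWords a b s₀ r ≤ symbolWords a b s₀ (.nonterminal (A, x)) := by
  have ctl : ∀ {K K' : List RegProg} {x y : List ℕ},
      CtlStep (K, x.map opDecode) (K', y.map opDecode) →
      formWords a b s₀ [.nonterminal (ntCode (.ctl K'), y)] ≤
        symbolWords a b s₀ (.nonterminal (ntCode (.ctl K), x)) := by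
    intro K K' x y hs
    rw [formWords_singleton]
    simp only [symbolWords, RegNonterminal.words, ntDecode_ntCode]
    rintro u ⟨w', h, rfl⟩
    exact ⟨w', .head hs h, rfl⟩
  cases h with
  | copy x h hp =>
    rcases hG _ h with ⟨K, hK⟩ | ⟨c, X, o, hX⟩ | ⟨c, X, hX⟩
    · match K, hK with
      | [], hK =>
        simp only [ctlProductions, List.mem_singleton, IndexedProduction.rewrite.injEq] at hK
        obtain ⟨rfl, rfl⟩ := hK
        have := formWords_counters a b s₀ false [.acc] x
        have h₂ := formWords_counters a b s₀ true [.acc] x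
        simp only [List.map_cons, List.map_nil, List.sum_singleton, RegCounter.count,
          cond_true, cond_false] at this h₂
        have h₃ := formWords_append a b s₀ [.nonterminal (ntCode (.cnt false .acc), x)]
          [.nonterminal (ntCode (.cnt true .acc), x)]
        rw [this, h₂, language_singleton_mul] at h₃
        simp only [IndexedGrammar.attach, ntSymbol, List.map_cons, List.map_nil]
        simp only [List.cons_append, List.nil_append] at h₃
        rw [h₃]
        rintro u rfl
        simp only [symbolWords, ntDecode_ntCode, RegNonterminal.words]
        exact ⟨_, .refl, rfl⟩
      | .op o :: K, hK => simp [ctlProductions] at hK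
      | .seq p q :: K, hK =>
        simp only [ctlProductions, List.mem_singleton, IndexedProduction.rewrite.injEq] at hK
        obtain ⟨rfl, rfl⟩ := hK
        exact ctl (.seq p q K _)
      | .star p :: K, hK =>
        simp only [ctlProductions, List.mem_cons, List.not_mem_nil, or_false,
          IndexedProduction.rewrite.injEq] at hK
        rcases hK with ⟨rfl, rfl⟩ | ⟨rfl, rfl⟩
        · exact ctl (.skip p K _)
        · exact ctl (.loop p K _)
    · simp [popProduction] at hX
    · simp only [bottomProduction, IndexedProduction.rewrite.injEq] at hX
      obtain ⟨rfl, rfl⟩ := hX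
      -- A bottom production has a purely terminal right-hand side, so it cannot be applied by the
      -- stack-copying rule.
      exact absurd (fun A hA => by simp at hA) hp
  | terminal h hp =>
    rcases hG _ h with ⟨K, hK⟩ | ⟨c, X, o, hX⟩ | ⟨c, X, hX⟩
    · exfalso
      match K, hK with
      | [], hK =>
        simp only [ctlProductions, List.mem_singleton, IndexedProduction.rewrite.injEq] at hK
        obtain ⟨rfl, rfl⟩ := hK
        exact hp _ (List.mem_cons_self ..)
      | .op o :: K, hK => simp [ctlProductions] at hK
      | .seq p q :: K, hK =>
        simp only [ctlProductions, List.mem_singleton, IndexedProduction.rewrite.injEq] at hK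
        obtain ⟨rfl, rfl⟩ := hK
        exact hp _ (List.mem_cons_self ..)
      | .star p :: K, hK =>
        simp only [ctlProductions, List.mem_cons, List.not_mem_nil, or_false,
          IndexedProduction.rewrite.injEq] at hK
        rcases hK with ⟨rfl, rfl⟩ | ⟨rfl, rfl⟩ <;> exact hp _ (List.mem_cons_self ..)
    · simp [popProduction] at hX
    · simp only [bottomProduction, IndexedProduction.rewrite.injEq] at hX
      obtain ⟨rfl, rfl⟩ := hX
      -- Here the restriction of terminal productions to the empty stack is essential: a counter
      -- cannot stop before all instructions have been popped.
      rw [attach_replicate_terminal, formWords_terminals]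
      simp [symbolWords, RegNonterminal.words]
  | push x h =>
    rcases hG _ h with ⟨K, hK⟩ | ⟨c, X, o, hX⟩ | ⟨c, X, hX⟩
    · match K, hK with
      | [], hK => simp [ctlProductions] at hK
      | .op o :: K, hK =>
        simp only [ctlProductions, List.mem_singleton, IndexedProduction.push.injEq] at hK
        obtain ⟨rfl, rfl, rfl⟩ := hK
        refine ctl ?_
        rw [List.map_cons, opDecode_opCode]
        exact .op o K _
      | .seq p q :: K, hK => simp [ctlProductions] at hK
      | .star p :: K, hK => simp [ctlProductions] at hK
    · simp [popProduction] at hX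
    · simp [bottomProduction] at hX
  | pop y h =>
    rcases hG _ h with ⟨K, hK⟩ | ⟨c, X, o, hX⟩ | ⟨c, X, hX⟩
    · match K, hK with
      | [], hK => simp [ctlProductions] at hK
      | .op o :: K, hK => simp [ctlProductions] at hK
      | .seq p q :: K, hK => simp [ctlProductions] at hK
      | .star p :: K, hK => simp [ctlProductions] at hK
    · simp only [popProduction, IndexedProduction.pop.injEq] at hX
      obtain ⟨rfl, rfl, rfl⟩ := hX
      rw [attach_map_ntSymbol, formWords_counters, RegCounter.sum_body]
      simp [symbolWords, RegNonterminal.words]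
    · simp [bottomProduction] at hX

theorem formWords_le_of_step {G : IndexedGrammar T}
    (hG : ∀ π ∈ G.productions, (∃ K, π ∈ ctlProductions K) ∨
      (∃ c X o, π = popProduction c X o) ∨ ∃ c X, π = bottomProduction a b s₀ c X)
    {q r : IndexedGrammar.SententialForm T} (h : Relation.ReflTransGen G.Step q r) :
    formWords a b s₀ r ≤ formWords a b s₀ q := by
  induction h with
  | refl => exact le_rfl
  | tail _ hstep ih =>
    obtain ⟨q₁, q₂, s, A, x, h, rfl, rfl⟩ := hstep
    refine le_trans ?_ ih
    simp only [formWords_append]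
    refine mul_le_mul' (mul_le_mul' le_rfl ?_) le_rfl
    rw [formWords_singleton]
    exact formWords_le_of_rewrites hG h

end Grammar

/-! ### Composition of derivations. -/

namespace IndexedGrammar

variable {T : Type*}

/-- The terminal word `u` is derivable from the sentential form `q`. -/
def Derives (G : IndexedGrammar T) (q : SententialForm T) (u : List T) : Prop :=
  Relation.ReflTransGen G.Step q (u.map .terminal)

theorem Step.append_left {G : IndexedGrammar T} {q r : SententialForm T}
    (h : Relation.ReflTransGen G.Step q r) (s : SententialForm T) :
    Relation.ReflTransGen G.Step (s ++ q) (s ++ r) := by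
  refine h.lift (s ++ ·) ?_
  rintro _ _ ⟨q₁, q₂, t, A, x, h, rfl, rfl⟩
  exact ⟨s ++ q₁, q₂, t, A, x, h, by simp, by simp⟩

theorem Step.append_right {G : IndexedGrammar T} {q r : SententialForm T}
    (h : Relation.ReflTransGen G.Step q r) (s : SententialForm T) :
    Relation.ReflTransGen G.Step (q ++ s) (r ++ s) := by
  refine h.lift (· ++ s) ?_
  rintro _ _ ⟨q₁, q₂, t, A, x, h, rfl, rfl⟩
  exact ⟨q₁, q₂ ++ s, t, A, x, h, by simp, by simp⟩

theorem Derives.append {G : IndexedGrammar T} {q r : SententialForm T} {u v : List T}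
    (hq : G.Derives q u) (hr : G.Derives r v) : G.Derives (q ++ r) (u ++ v) := by
  rw [Derives, List.map_append]
  exact (Step.append_right hq r).trans (Step.append_left hr _)

theorem Derives.of_rewrites {G : IndexedGrammar T} {A : ℕ} {x : List ℕ} {r : SententialForm T}
    {u : List T} (h : G.Rewrites A x r) (hr : G.Derives r u) :
    G.Derives [.nonterminal (A, x)] u :=
  .head ⟨[], [], r, A, x, h, by simp, by simp⟩ hr

end IndexedGrammar

/-! ### Finiteness of the symbols needed for a given program. -/

namespace RegOp

/-- The entries read by an instruction. -/
def entries : RegOp → List (Option ℕ)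
  | copy _ j => [some j]
  | test i j => [some i, some j]
  | _ => []

theorem mem_row {o : RegOp} {k l : Option ℕ} (h : l ∈ o.row k) :
    l = k ∨ l = none ∨ l ∈ o.entries := by
  cases k with
  | none => cases o <;> simp_all [row]
  | some k =>
    cases o <;> simp only [row] at h
    case zero i => by_cases h' : k = i <;> simp_all
    case inc i => by_cases h' : k = i <;> simp [h'] at h ⊢ <;> tauto
    case copy i _ => by_cases h' : k = i <;> simp_all [entries]
    case test => simp_all

end RegOp

namespace RegProg

/-- The control states of a program. -/
def states (P : RegProg) : List (List RegProg) := [] :: support P []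

/-- The instruction executed next in a control state. -/
def nextOps : List RegProg → List RegOp
  | .op o :: _ => [o]
  | _ => []

/-- The instructions of a program. -/
def ops (P : RegProg) : List RegOp := P.states.flatMap nextOps

/-- The entries needed for the counters of a program. -/
def allEntries (P : RegProg) : List (Option ℕ) := none :: P.ops.flatMap RegOp.entries

/-- The counters of a program. -/
def counters (P : RegProg) : List RegCounter :=
  .acc :: P.allEntries.flatMap fun i => P.allEntries.map fun j => .mul i j

theorem mem_states_of_ctlStep {P : RegProg} {c c' : List RegProg × List RegOp}
    (h : CtlStep c c') (hc : c.1 ∈ P.states) : c'.1 ∈ P.states := by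
  rcases List.mem_cons.1 hc with hc | hc
  · cases h <;> simp at hc
  · rcases support_closed h hc with h' | h' <;> simp [states, h']

theorem mem_ops {P : RegProg} {o : RegOp} {K : List RegProg} (h : .op o :: K ∈ P.states) :
    o ∈ P.ops :=
  List.mem_flatMap.2 ⟨_, h, List.mem_singleton_self o⟩

/-- Going back over an instruction replaces an entry only by itself, the constant, or an entry that
the instruction reads. -/
theorem body_subset_counters {P : RegProg} {c : Bool} {X Y : RegCounter} {o : RegOp}
    (hX : X ∈ P.counters) (ho : o ∈ P.ops) (hY : Y ∈ X.body c o) : Y ∈ P.counters := by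
  have entries : ∀ i ∈ o.entries, i ∈ P.allEntries := fun i hi =>
    List.mem_cons_of_mem _ (List.mem_flatMap.2 ⟨o, ho, hi⟩)
  have mul : ∀ {i j : Option ℕ}, .mul i j ∈ P.counters ↔ i ∈ P.allEntries ∧ j ∈ P.allEntries := by
    simp [counters]
  cases X with
  | acc =>
    cases o with
    | test i j =>
      have hi := entries (some i) (by simp [RegOp.entries])
      have hj := entries (some j) (by simp [RegOp.entries])
      cases c <;> simp only [RegCounter.body, cond_true, cond_false, List.mem_append,
        List.mem_cons, List.not_mem_nil, or_false] at hY <;>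
        rcases hY with (rfl | rfl) | rfl <;> simp [mul, hi, hj, hX]
    | _ =>
      simp only [RegCounter.body, List.mem_singleton] at hY
      rwa [hY]
  | mul i j =>
    simp only [RegCounter.body, List.mem_flatMap, List.mem_map] at hY
    obtain ⟨k, hk, l, hl, rfl⟩ := hY
    have row : ∀ {k l : Option ℕ}, l ∈ o.row k → k ∈ P.allEntries → l ∈ P.allEntries := by
      intro k l h hk
      rcases RegOp.mem_row h with rfl | rfl | h
      · exact hk
      · exact List.mem_cons_self ..
      · exact entries _ h
    obtain ⟨hi, hj⟩ := mul.1 hX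
    exact mul.2 ⟨row hk hi, row hl hj⟩

end RegProg

/-! ### The grammar of a program and its language. -/

section Grammar

variable {T : Type*}

/-- The productions that do not depend on the initial register contents. -/
noncomputable def innerProductions (P : RegProg) : List (IndexedProduction T) :=
  P.states.flatMap ctlProductions ++
    P.counters.flatMap fun X => P.ops.flatMap fun o =>
      [popProduction false X o, popProduction true X o]

/-- The grammar that generates the words `aᵐbⁿ`, where `m` and `n` are the two sums of tests for
a run of the program `P` from the initial register contents `s₀`. -/
noncomputable def regGrammar (a b : T) (P : RegProg) (s₀ : RegState) : IndexedGrammar T where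
  nonterminals := P.states.map (fun K => ntCode (.ctl K)) ++
    (P.counters.map (fun X => ntCode (.cnt false X)) ++
      P.counters.map fun X => ntCode (.cnt true X))
  indices := P.ops.map opCode
  productions := innerProductions P ++
    (P.counters.map (bottomProduction a b s₀ false) ++
      P.counters.map (bottomProduction a b s₀ true))
  start := ntCode (.ctl [P])

variable {a b : T} {P : RegProg} {s₀ : RegState}

theorem mem_productions {π : IndexedProduction T} :
    π ∈ (regGrammar a b P s₀).productions ↔
      (∃ K ∈ P.states, π ∈ ctlProductions K) ∨
      (∃ c, ∃ X ∈ P.counters, ∃ o ∈ P.ops, π = popProduction c X o) ∨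
      ∃ c, ∃ X ∈ P.counters, π = bottomProduction a b s₀ c X := by
  simp only [regGrammar, innerProductions, List.mem_append, List.mem_flatMap, List.mem_map,
    List.mem_cons, List.not_mem_nil, or_false, Bool.exists_bool, or_assoc, eq_comm (b := π),
    and_or_left, exists_or]

theorem ctl_mem_nonterminals {K : List RegProg} (hK : K ∈ P.states) :
    ntCode (.ctl K) ∈ (regGrammar a b P s₀).nonterminals :=
  List.mem_append_left _ (List.mem_map_of_mem hK)

theorem cnt_mem_nonterminals (c : Bool) {X : RegCounter} (hX : X ∈ P.counters) :
    ntCode (.cnt c X) ∈ (regGrammar a b P s₀).nonterminals := by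
  refine List.mem_append_right _ ?_
  cases c
  · exact List.mem_append_left _ (List.mem_map.2 ⟨X, hX, rfl⟩)
  · exact List.mem_append_right _ (List.mem_map.2 ⟨X, hX, rfl⟩)

theorem acc_mem_counters : .acc ∈ P.counters := List.mem_cons_self ..

theorem start_mem_states : [P] ∈ P.states :=
  List.mem_cons_of_mem _ (RegProg.cons_mem_support P [])

theorem regGrammar_wellFormed : (regGrammar a b P s₀).WellFormed := by
  have word : ∀ {p : List RegNonterminal},
      (∀ X ∈ p, ntCode X ∈ (regGrammar a b P s₀).nonterminals) →
      IndexedGrammar.IsWordOver (regGrammar a b P s₀).nonterminals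
        (p.map (ntSymbol (T := T))) := by
    intro p hp A hA
    obtain ⟨X, hX, h⟩ := List.mem_map.1 hA
    cases h
    exact hp X hX
  refine ⟨ctl_mem_nonterminals start_mem_states, ?_, ?_, ?_⟩
  · intro A w h
    rcases mem_productions.1 h with ⟨K, hK, h⟩ | ⟨c, X, hX, o, ho, h⟩ | ⟨c, X, hX, h⟩
    · match K, hK, h with
      | [], hK, h =>
        simp only [ctlProductions, List.mem_singleton, IndexedProduction.rewrite.injEq] at h
        obtain ⟨rfl, rfl⟩ := h
        refine ⟨ctl_mem_nonterminals hK, word (p := [.cnt false .acc, .cnt true .acc]) ?_⟩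
        simp [cnt_mem_nonterminals, acc_mem_counters]
      | .op o :: K, _, h => simp [ctlProductions] at h
      | .seq p q :: K, hK, h =>
        simp only [ctlProductions, List.mem_singleton, IndexedProduction.rewrite.injEq] at h
        obtain ⟨rfl, rfl⟩ := h
        refine ⟨ctl_mem_nonterminals hK, word (p := [.ctl (p :: q :: K)]) ?_⟩
        have := RegProg.mem_states_of_ctlStep (.seq p q K []) hK
        simp [ctl_mem_nonterminals this]
      | .star p :: K, hK, h =>
        simp only [ctlProductions, List.mem_cons, List.not_mem_nil, or_false,
          IndexedProduction.rewrite.injEq] at h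
        rcases h with ⟨rfl, rfl⟩ | ⟨rfl, rfl⟩
        · refine ⟨ctl_mem_nonterminals hK, word (p := [.ctl K]) ?_⟩
          have := RegProg.mem_states_of_ctlStep (.skip p K []) hK
          simp [ctl_mem_nonterminals this]
        · refine ⟨ctl_mem_nonterminals hK, word (p := [.ctl (p :: .star p :: K)]) ?_⟩
          have := RegProg.mem_states_of_ctlStep (.loop p K []) hK
          simp [ctl_mem_nonterminals this]
    · simp [popProduction] at h
    · simp only [bottomProduction, IndexedProduction.rewrite.injEq] at h
      obtain ⟨rfl, rfl⟩ := h
      exact ⟨cnt_mem_nonterminals c hX, fun A hA => by simp at hA⟩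
  · intro A B f h
    rcases mem_productions.1 h with ⟨K, hK, h⟩ | ⟨c, X, hX, o, ho, h⟩ | ⟨c, X, hX, h⟩
    · match K, hK, h with
      | [], _, h => simp [ctlProductions] at h
      | .op o :: K, hK, h =>
        simp only [ctlProductions, List.mem_singleton, IndexedProduction.push.injEq] at h
        obtain ⟨rfl, rfl, rfl⟩ := h
        exact ⟨ctl_mem_nonterminals hK,
          ctl_mem_nonterminals (RegProg.mem_states_of_ctlStep (.op o K []) hK),
          List.mem_map_of_mem (RegProg.mem_ops hK)⟩
      | .seq p q :: K, _, h => simp [ctlProductions] at h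
      | .star p :: K, _, h => simp [ctlProductions] at h
    · simp [popProduction] at h
    · simp [bottomProduction] at h
  · intro A f w h
    rcases mem_productions.1 h with ⟨K, hK, h⟩ | ⟨c, X, hX, o, ho, h⟩ | ⟨c, X, hX, h⟩
    · match K, h with
      | [], h => simp [ctlProductions] at h
      | .op o :: K, h => simp [ctlProductions] at h
      | .seq p q :: K, h => simp [ctlProductions] at h
      | .star p :: K, h => simp [ctlProductions] at h
    · simp only [popProduction, IndexedProduction.pop.injEq] at h
      obtain ⟨rfl, rfl, rfl⟩ := h
      refine ⟨cnt_mem_nonterminals c hX, List.mem_map_of_mem ho, ?_⟩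
      have := word (p := (X.body c o).map fun Y => .cnt c Y) (by
        intro Z hZ
        obtain ⟨Y, hY, rfl⟩ := List.mem_map.1 hZ
        exact cnt_mem_nonterminals c (RegProg.body_subset_counters hX ho hY))
      simpa [Function.comp_def] using this
    · simp [bottomProduction] at h

/-- Completeness for counters: induction on the stack, concatenating the derivations of the counters
on the right-hand side of each pop production. -/
theorem derives_counter (c : Bool) {w : List RegOp} (hw : ∀ o ∈ w, o ∈ P.ops) :
    ∀ {X : RegCounter}, X ∈ P.counters →
    (regGrammar a b P s₀).Derives [.nonterminal (ntCode (.cnt c X), w.map opCode)]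
      (List.replicate (X.count s₀ c w) (bif c then b else a)) := by
  induction w with
  | nil =>
    intro X hX
    have h : bottomProduction a b s₀ c X ∈ (regGrammar a b P s₀).productions :=
      mem_productions.2 (.inr (.inr ⟨c, X, hX, rfl⟩))
    refine .of_rewrites (.terminal h fun A hA => by simp at hA) ?_
    rw [attach_replicate_terminal]
    exact .refl
  | cons o w ih =>
    intro X hX
    have ho := hw o (List.mem_cons_self ..)
    have h : popProduction c X o ∈ (regGrammar a b P s₀).productions :=
      mem_productions.2 (.inr (.inl ⟨c, X, hX, o, ho, rfl⟩))
    refine .of_rewrites (.pop _ h) ?_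
    rw [attach_map_ntSymbol, ← RegCounter.sum_body]
    have hL : ∀ Y ∈ X.body c o, Y ∈ P.counters := fun Y hY =>
      RegProg.body_subset_counters hX ho hY
    generalize X.body c o = L at hL
    induction L with
    | nil => exact .refl
    | cons Y L ihL =>
      rw [List.map_cons, List.map_cons, List.sum_cons, List.replicate_add, ← List.singleton_append]
      exact (ih (fun o' ho' => hw o' (List.mem_cons_of_mem _ ho')) (hL Y (List.mem_cons_self ..))).append
        (ihL fun Z hZ => hL Z (List.mem_cons_of_mem _ hZ))

theorem derives_ctl {c : List RegProg × List RegOp} {w' : List RegOp}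
    (h : Relation.ReflTransGen CtlStep c ([], w')) :
    c.1 ∈ P.states → (∀ o ∈ c.2, o ∈ P.ops) →
    (regGrammar a b P s₀).Derives [.nonterminal (ntCode (.ctl c.1), c.2.map opCode)]
      (List.replicate (testSum s₀ false w') a ++ List.replicate (testSum s₀ true w') b) := by
  induction h using Relation.ReflTransGen.head_induction_on with
  | refl =>
    intro hK hw
    -- In the empty control state the whole stack is handed to both counters.
    refine .of_rewrites (.copy _ (mem_productions.2 (.inl ⟨_, hK, List.mem_singleton_self _⟩))
      fun h => h _ (List.mem_cons_self ..)) ?_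
    exact (derives_counter false hw acc_mem_counters).append
      (derives_counter true hw acc_mem_counters)
  | head hstep _ ih =>
    intro hK hw
    have hK' := RegProg.mem_states_of_ctlStep hstep hK
    cases hstep with
    | op o K w =>
      refine .of_rewrites (.push _ (mem_productions.2 (.inl ⟨_, hK, List.mem_singleton_self _⟩)))
        (ih hK' ?_)
      simpa using ⟨RegProg.mem_ops hK, hw⟩
    | seq p q K w =>
      exact .of_rewrites (.copy _ (mem_productions.2 (.inl ⟨_, hK, List.mem_singleton_self _⟩))
        fun h => h _ (List.mem_cons_self ..)) (ih hK' hw)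
    | skip p K w =>
      exact .of_rewrites (.copy _ (mem_productions.2 (.inl ⟨_, hK, List.mem_cons_self ..⟩))
        fun h => h _ (List.mem_cons_self ..)) (ih hK' hw)
    | loop p K w =>
      exact .of_rewrites (.copy _ (mem_productions.2 (.inl ⟨_, hK,
        List.mem_cons_of_mem _ (List.mem_singleton_self _)⟩))
        fun h => h _ (List.mem_cons_self ..)) (ih hK' hw)

theorem mem_regGrammar_language {u : List T} :
    u ∈ (regGrammar a b P s₀).language ↔
      ∃ w, Relation.ReflTransGen CtlStep ([P], []) ([], w) ∧
        u = List.replicate (testSum s₀ false w) a ++ List.replicate (testSum s₀ true w) b := by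
  constructor
  · intro h
    -- A terminal word has itself as its only intended word, so it belongs to the intended language
    -- of the start symbol.
    have := formWords_le_of_step (a := a) (b := b) (s₀ := s₀) (G := regGrammar a b P s₀) (by
      intro π hπ
      rcases mem_productions.1 hπ with ⟨K, -, h⟩ | ⟨c, X, -, o, -, h⟩ | ⟨c, X, -, h⟩
      · exact .inl ⟨K, h⟩
      · exact .inr (.inl ⟨c, X, o, h⟩)
      · exact .inr (.inr ⟨c, X, h⟩)) h
    rw [formWords_terminals, formWords_singleton] at this
    have hu := this (show u ∈ ({u} : Language T) from rfl)
    simpa [symbolWords, regGrammar, RegNonterminal.words] using hu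
  · rintro ⟨w, h, rfl⟩
    exact derives_ctl h start_mem_states (by simp)

theorem regGrammar_language_le : (regGrammar a b P s₀).language ≤ aStarBStar a b := by
  intro u hu
  obtain ⟨w, -, rfl⟩ := mem_regGrammar_language.1 hu
  exact ⟨_, _, rfl⟩

theorem replicate_append_replicate_inj {a b : T} (hab : a ≠ b) {i j k l : ℕ}
    (h : List.replicate i a ++ List.replicate j b = List.replicate k a ++ List.replicate l b) :
    i = k ∧ j = l := by
  classical
  have h₁ := congrArg (List.count a) h
  have h₂ := congrArg (List.count b) h
  simp only [List.count_append, List.count_replicate, beq_iff_eq, hab, hab.symm, if_true,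
    if_false] at h₁ h₂
  omega

theorem exists_mem_regGrammar_language (hab : a ≠ b) :
    (∃ n : ℕ, List.replicate n a ++ List.replicate n b ∈ (regGrammar a b P s₀).language) ↔
      ∃ s', P.Exec s₀ s' := by
  rw [RegProg.exists_exec_iff]
  constructor
  · rintro ⟨n, hn⟩
    obtain ⟨w, hw, h⟩ := mem_regGrammar_language.1 hn
    obtain ⟨h₁, h₂⟩ := replicate_append_replicate_inj hab h
    exact ⟨w, hw, (testSum_le s₀ w).2.1 (h₁.symm.trans h₂)⟩
  · rintro ⟨w, hw, h⟩
    refine ⟨testSum s₀ true w, mem_regGrammar_language.2 ⟨w, hw, ?_⟩⟩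
    rw [(testSum_le s₀ w).2.2 h]

end Grammar

/-! ### Computability of the reduction and the halting problem. -/

/-- The initial register contents on input `n`. -/
def inputState (n : ℕ) : RegState := fun i => if i = 0 then n else 0

section Computability

open Primrec

variable {T : Type*} [Primcodable T]

theorem primrec_replicate (t : T) : Primrec fun n => List.replicate n t :=
  (list_map list_range (Primrec.const t).to₂).of_eq fun n => by simp

theorem primrec_map_list {α β γ : Type*} [Primcodable α] [Primcodable γ] (L : List β)
    {h : β → α → γ} (hh : ∀ x, Primrec (h x)) : Primrec fun n => L.map fun x => h x n := by
  induction L with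
  | nil => exact Primrec.const []
  | cons x L ih => exact list_cons.comp (hh x) ih

theorem primrec_extVal_inputState (i : Option ℕ) : Primrec fun n => extVal (inputState n) i := by
  cases i with
  | none => exact Primrec.const 1
  | some i =>
    by_cases h : i = 0
    · exact Primrec.id.of_eq fun n => by simp [extVal, inputState, h]
    · exact (Primrec.const 0).of_eq fun n => by simp [extVal, inputState, h]

theorem primrec_bottomProduction (a b : T) (c : Bool) (X : RegCounter) :
    Primrec fun n => bottomProduction a b (inputState n) c X := by
  have hcount : Primrec fun n => X.count (inputState n) c [] := by
    cases X with
    | acc => exact Primrec.const 0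
    | mul i j =>
      exact nat_mul.comp (primrec_extVal_inputState i) (primrec_extVal_inputState j)
  exact (of_equiv_symm (e := indexedProductionEquiv T)).comp
    (sumInl.comp ((Primrec.const (ntCode (.cnt c X))).pair
      ((primrec_replicate (Symbol.terminal (bif c then b else a))).comp hcount)))

/-- The naming functions `ntCode` and `opCode` are noncomputable, but for fixed `P` only finitely
many of their values occur, and these are constants. -/
theorem primrec_regGrammar (a b : T) (P : RegProg) :
    Primrec fun n => regGrammar a b P (inputState n) := by
  have hprod : Primrec fun n => (regGrammar a b P (inputState n)).productions :=
    list_append.comp (Primrec.const _) (list_append.comp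
      (primrec_map_list _ fun X => primrec_bottomProduction a b false X)
      (primrec_map_list _ fun X => primrec_bottomProduction a b true X))
  -- Nonterminals, indices and start symbol are independent of the register contents, so they may be
  -- taken from the grammar with all registers `0`.
  exact (of_equiv_symm (e := indexedGrammarEquiv T)).comp
    ((Primrec.const (regGrammar a b P 0).nonterminals).pair
      ((Primrec.const (regGrammar a b P 0).indices).pair
        (hprod.pair (Primrec.const (regGrammar a b P 0).start))))

end Computability

theorem exists_universal_regProg : ∃ P : RegProg, ∀ n,
    (∃ s', P.Exec (inputState n) s') ↔
      ((Denumerable.ofNat Nat.Partrec.Code n).eval 0).Dom := by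
  have hf : Partrec fun n => (Denumerable.ofNat Nat.Partrec.Code n).eval 0 :=
    Nat.Partrec.Code.eval_part.comp (Computable.ofNat _) (Computable.const 0)
  -- The input is in register `0`, where `inputState` places it, and the output goes to register
  -- `1`; hence the bound `2`.
  obtain ⟨P, hP, hP'⟩ := RegProg.realizable_of_partrec' (Nat.Partrec'.part_iff₁.2 hf)
    (fun _ => 0) 1 2 (by simp) (by simp)
  refine ⟨P, fun n => ?_⟩
  constructor
  · rintro ⟨s', h⟩
    exact Part.dom_iff_mem.2 ⟨_, (hP _ _ h).2⟩
  · intro h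
    obtain ⟨y, hy⟩ := Part.dom_iff_mem.1 h
    obtain ⟨s', h', -⟩ := hP' (inputState n) y hy
    exact ⟨s', h'⟩

theorem not_computablePred_ofNat_eval_dom :
    ¬ ComputablePred fun n => ((Denumerable.ofNat Nat.Partrec.Code n).eval 0).Dom := by
  intro h
  refine ComputablePred.halting_problem 0 ?_
  obtain ⟨f, hf, h⟩ := ComputablePred.computable_iff.1 h
  refine ComputablePred.computable_iff.2 ⟨fun c => f (Encodable.encode c),
    hf.comp Computable.encode, ?_⟩
  funext c
  have := congrFun h (Encodable.encode c)
  simpa using this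

/-- A promise problem is undecidable if the halting problem reduces to it. -/
theorem not_decidableGiven_of_reduction {α : Type*} [Primcodable α] {promise p : α → Prop}
    {q : ℕ → Prop} (hq : ¬ ComputablePred q) {g : ℕ → α} (hg : Computable g)
    (hpromise : ∀ n, promise (g n)) (hp : ∀ n, p (g n) ↔ q n) : ¬ DecidableGiven promise p := by
  rintro ⟨f, hf, h⟩
  choose answer hmem hanswer using fun n => h (g n) (hpromise n)
  refine hq (ComputablePred.computable_iff.2 ⟨answer, ?_, ?_⟩)
  · exact (hf.comp hg).of_eq fun n => Part.eq_some_iff.2 (hmem n)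
  · funext n
    exact propext ((hp n).symm.trans (hanswer n).symm)

theorem mainTheorem6 {T : Type*} [Primcodable T] (a b : T) (hab : a ≠ b) :
    ¬ DecidableGiven
      (fun G : IndexedGrammar T => G.WellFormed ∧ G.language ≤ aStarBStar a b)
      (fun G : IndexedGrammar T =>
        ∃ n : ℕ, List.replicate n a ++ List.replicate n b ∈ G.language) := by
  obtain ⟨P, hP⟩ := exists_universal_regProg
  exact not_decidableGiven_of_reduction not_computablePred_ofNat_eval_dom
    (primrec_regGrammar a b P).to_comp
    (fun _ => ⟨regGrammar_wellFormed, regGrammar_language_le⟩)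
    fun n => (exists_mem_regGrammar_language hab).trans (hP n)
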